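/- Let $T$ be a complete first-order theory with only infinite models, in a vocabulary $\tau$, and write $|T| := |\tau| + \aleph_0$. Let $\lambda > |T|$ be a cardinal such that $T$ is stable in $\lambda$: for every set $A$ of cardinality $\lambda$ of elements of a model of $T$, there are exactly $\lambda$ complete types over $A$ in one variable (that is, types over $A$ of single elements of a monster model). Then for every model $M$ of $T$ and every sequence $\langle a_i : i < \lambda^+ \rangle$ of (not necessarily distinct) elements of $M$, there exists $I \subseteq \lambda^+$ of cardinality $\lambda^+$ such that $\langle a_i : i \in I \rangle$ is indiscernible: for all $n < \omega$, all $i_1 < \dots < i_n$ and $j_1 < \dots < j_n$ in $I$, and every $\tau$-formula $\varphi(x_1, \dots, x_n)$, we have $M \models \varphi[a_{i_1}, \dots, a_{i_n}]$ if and only if $M \models \varphi[a_{j_1}, \dots, a_{j_n}]$. -/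

import Mathlib

open FirstOrder Cardinal

universe u v w w'

namespace FirstOrder.Language

/-- The cardinal `|T| = |τ| + ℵ₀` attached to a theory `T` in the vocabulary `τ = L`. -/
def Theory.size {L : Language.{u, v}} (_T : L.Theory) : Cardinal.{max u v} :=
  L.card + ℵ₀

/-- The space `S(A)` of complete types in one variable over a set `A` of parameters in `M`:
the maximal consistent sets of formulas `φ(x)` with parameters in `A` that extend
the complete theory of `(M, a)_{a ∈ A}`. By compactness, these are exactly the types
over `A` of the single elements of (sufficiently saturated) elementary extensions of `M`. -/
abbrev OneTypes (L : Language.{u, v}) {M : Type w} [L.Structure M] (A : Set M) :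
    Type (max u v w) :=
  (L[[A]].completeTheory M).CompleteType (Fin 1)

/-- `T` is stable in `κ`: over every set `A` of cardinality `κ` (in any model of `T`),
there are exactly `κ` complete types in one variable. -/
def Theory.IsStableIn {L : Language.{u, v}} (T : L.Theory) (κ : Cardinal.{w}) : Prop :=
  ∀ (M : Type w) [L.Structure M] [M ⊨ T] [Nonempty M] (A : Set M),
    #A = κ → #(L.OneTypes A) = Cardinal.lift.{max u v} κ

/-- A sequence `⟨a i : i ∈ ι⟩` of elements of `M`, indexed by a linear order, is indiscernible:
any two finite strictly increasing tuples of indices of the same length give tuples of elements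
that have the same complete type (over the empty set) in `M`. -/
def IsIndiscernible (L : Language.{u, v}) {M : Type w} [L.Structure M]
    {ι : Type w'} [LinearOrder ι] (a : ι → M) : Prop :=
  ∀ (n : ℕ) (s t : Fin n → ι), StrictMono s → StrictMono t →
    ∀ φ : L.Formula (Fin n), φ.Realize (a ∘ s) ↔ φ.Realize (a ∘ t)

end FirstOrder.Language

/-! Stability in `κ` bounds the height of the binary trees of each formula: otherwise compactness
yields more than `κ` types over `κ` parameters (`Splits.exists_bound`). An instance of least tree
height in a type then defines its `φ`-part (`exists_finite_definable`), so every type over `X` is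
definable over at most `|T|` elements of `X`. Such a parameter set is absorbed by one member of any
chain of `|T|⁺ ≤ κ` models. Hence some model `N` of size `κ` and some type over `N` work for
cofinally many `a i`, even with the type of `a i` over a given larger set of size at most `κ`
definable over `N` (`exists_elementarySubstructure_definableTypeOver`). Choosing indices
recursively, each with type definable over `N` on the earlier terms, gives an indiscernible
sequence: the type over `N` determines the defining scheme (`mem_iff_of_definableTypeOver`). -/

namespace FirstOrder.Language

/-! ### Bounded trees and definability of types -/

/-- `Splits R n P`: there is a full binary tree of height `n` of instances of the relation `R`,
all of whose branches are realized by points satisfying `P`. -/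
def Splits {α : Type*} {β : Type*} (R : α → β → Prop) : ℕ → (α → Prop) → Prop
  | 0, P => ∃ x, P x
  | n + 1, P => ∃ y, Splits R n (fun x => P x ∧ R x y) ∧ Splits R n (fun x => P x ∧ ¬ R x y)

/-- The type of `e` over `X` is definable over `B`, formula by formula. -/
def DefinableTypeOver (L : Language.{u, v}) {M : Type w} [L.Structure M] (e : M) (X B : Set M) :
    Prop :=
  ∀ (m : ℕ) (φ : L.Formula (Unit ⊕ Fin m)), ∃ D : Set (Fin m → M), B.Definable L D ∧
    ∀ b : Fin m → M, (∀ k, b k ∈ X) → (φ.Realize (Sum.elim (fun _ => e) b) ↔ b ∈ D)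

theorem DefinableTypeOver.mono {L : Language.{u, v}} {M : Type w} [L.Structure M] {e : M}
    {X Y B C : Set M} (h : L.DefinableTypeOver e X B) (hY : Y ⊆ X) (hC : B ⊆ C) :
    L.DefinableTypeOver e Y C := by
  intro m φ
  obtain ⟨D, hD, h⟩ := h m φ
  exact ⟨D, hD.mono hC, fun b hb => h b fun k => hY (hb k)⟩

section

variable {L : Language.{u, v}} {M : Type w} [L.Structure M]

/-- A tree of fixed finite height is first-order expressible. `χ` and `γ` vary because each level
adds its node to the parameters. -/
theorem exists_formula_splits {m : ℕ} (φ : L.Formula (Unit ⊕ Fin m)) (n : ℕ) :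
    ∀ (γ : Type) (χ : L.Formula (Unit ⊕ γ)), ∃ ψ : L.Formula γ, ∀ z : γ → M, ψ.Realize z ↔
      Splits (fun (x : M) (y : Fin m → M) => φ.Realize (Sum.elim (fun _ => x) y)) n
        (fun x => χ.Realize (Sum.elim (fun _ => x) z)) := by
  induction n with
  | zero =>
    intro γ χ
    refine ⟨(χ.relabel (Sum.swap)).iExs Unit, fun z => ?_⟩
    simp only [Formula.realize_iExs, Formula.realize_relabel, Splits]
    constructor
    · rintro ⟨i, hi⟩
      refine ⟨i (), ?_⟩
      convert hi using 1
      ext (k | k) <;> rfl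
    · rintro ⟨x, hx⟩
      refine ⟨fun _ => x, ?_⟩
      convert hx using 1
      ext (k | k) <;> rfl
  | succ n ih =>
    intro γ χ
    let χ' : L.Formula (Unit ⊕ (γ ⊕ Fin m)) := χ.relabel (Sum.map id Sum.inl)
    let φ' : L.Formula (Unit ⊕ (γ ⊕ Fin m)) := φ.relabel (Sum.map id Sum.inr)
    obtain ⟨ψ₁, h₁⟩ := ih (γ ⊕ Fin m) (χ' ⊓ φ')
    obtain ⟨ψ₀, h₀⟩ := ih (γ ⊕ Fin m) (χ' ⊓ φ'.not)
    refine ⟨(ψ₁ ⊓ ψ₀).iExs (Fin m), fun z => ?_⟩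
    have e₁ : ∀ (x : M) (y : Fin m → M), χ'.Realize (Sum.elim (fun _ => x) (Sum.elim z y)) ↔
        χ.Realize (Sum.elim (fun _ => x) z) := fun x y => by
      simp only [χ', Formula.realize_relabel]
      convert Iff.rfl using 2
      ext (k | k) <;> rfl
    have e₂ : ∀ (x : M) (y : Fin m → M), φ'.Realize (Sum.elim (fun _ => x) (Sum.elim z y)) ↔
        φ.Realize (Sum.elim (fun _ => x) y) := fun x y => by
      simp only [φ', Formula.realize_relabel]
      convert Iff.rfl using 2
      ext (k | k) <;> rfl
    simp only [Formula.realize_iExs, Formula.realize_inf, h₁, h₀, Formula.realize_not, e₁, e₂,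
      Splits]

theorem definable_setOf_realize {γ δ : Type*} {B : Set M} (ψ : L.Formula (δ ⊕ γ)) (c : γ → M)
    (hc : ∀ k, c k ∈ B) : B.Definable L {b : δ → M | ψ.Realize (Sum.elim b c)} := by
  rw [Set.definable_iff_exists_formula_sum]
  refine ⟨ψ.relabel (Sum.elim Sum.inr fun k => Sum.inl ⟨c k, hc k⟩), ?_⟩
  ext b
  simp only [Set.mem_ofPred_eq, Formula.realize_relabel]
  convert Iff.rfl using 2
  ext (k | k) <;> rfl

/-- If `φ` does not have binary trees of all finite heights, the `φ`-type of any element over any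
set is definable over finitely many parameters from that set. -/
theorem exists_finite_definable {m : ℕ} (φ : L.Formula (Unit ⊕ Fin m))
    (hφ : ∃ n, ¬ Splits (fun (x : M) (y : Fin m → M) => φ.Realize (Sum.elim (fun _ => x) y)) n
      (fun _ => True)) (e : M) (X : Set M) :
    ∃ B : Set M, B.Finite ∧ B ⊆ X ∧ ∃ D : Set (Fin m → M), B.Definable L D ∧
      ∀ b : Fin m → M, (∀ k, b k ∈ X) → (φ.Realize (Sum.elim (fun _ => e) b) ↔ b ∈ D) := by
  classical
  set R := fun (x : M) (y : Fin m → M) => φ.Realize (Sum.elim (fun _ => x) y) with hR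
  -- `Q n`: some formula in the type of `e` over `X` admits no tree of height `n`. The least such
  -- `n` is used, and it is positive since `e` witnesses height 0.
  let Q : ℕ → Prop := fun n => ∃ (γ : Type) (_ : Finite γ) (χ : L.Formula (Unit ⊕ γ)) (c : γ → M),
    (∀ k, c k ∈ X) ∧ χ.Realize (Sum.elim (fun _ => e) c) ∧
      ¬ Splits R n (fun x => χ.Realize (Sum.elim (fun _ => x) c))
  have hQ : ∃ n, Q n := by
    obtain ⟨n, hn⟩ := hφ
    refine ⟨n, Empty, inferInstance, ⊤, Empty.elim, fun k => k.elim, ?_, ?_⟩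
    · simp
    · simpa using hn
  obtain ⟨γ, hγ, χ, c, hc, hχ, hn⟩ := Nat.find_spec hQ
  have hmin := fun n => Nat.find_min hQ (m := n)
  generalize Nat.find hQ = n at hn hmin
  cases n with
  | zero => exact (hn ⟨e, hχ⟩).elim
  | succ n =>
    have hmin := hmin n (Nat.lt_succ_self n)
    let χ' : L.Formula (Unit ⊕ (Fin m ⊕ γ)) := χ.relabel (Sum.map id Sum.inr)
    let φ' : L.Formula (Unit ⊕ (Fin m ⊕ γ)) := φ.relabel (Sum.map id Sum.inl)
    have e₁ : ∀ (x : M) (y : Fin m → M), χ'.Realize (Sum.elim (fun _ => x) (Sum.elim y c)) ↔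
        χ.Realize (Sum.elim (fun _ => x) c) := fun x y => by
      simp only [χ', Formula.realize_relabel]
      convert Iff.rfl using 2
      ext (k | k) <;> rfl
    have e₂ : ∀ (x : M) (y : Fin m → M), φ'.Realize (Sum.elim (fun _ => x) (Sum.elim y c)) ↔
        R x y := fun x y => by
      simp only [φ', Formula.realize_relabel, hR]
      convert Iff.rfl using 2
      ext (k | k) <;> rfl
    -- The definition says that `χ ∧ φ(x, b)` has a tree of height `n`. By minimality this holds
    -- whenever `φ(e, b)` does. If it held with `φ(e, b)` false, `χ ∧ ¬φ(x, b)` would have one too,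
    -- and `b` would root a tree of height `n + 1` in `χ`.
    obtain ⟨ψ, hψ⟩ := exists_formula_splits (M := M) φ n (Fin m ⊕ γ) (χ' ⊓ φ')
    refine ⟨Set.range c, Set.finite_range c, Set.range_subset_iff.2 hc,
      _, definable_setOf_realize ψ c (fun k => ⟨k, rfl⟩), fun b hb => ?_⟩
    have hmem : ∀ k, Sum.elim b c k ∈ X := by
      rintro (k | k)
      · exact hb k
      · exact hc k
    rw [Set.mem_ofPred_eq, hψ]
    simp only [Formula.realize_inf, e₁, e₂]
    change R e b ↔ _
    constructor
    · intro h
      by_contra hcon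
      refine hmin ⟨Fin m ⊕ γ, inferInstance, χ' ⊓ φ', Sum.elim b c, hmem, ?_, ?_⟩
      · simpa only [Formula.realize_inf, e₁, e₂] using ⟨hχ, h⟩
      · simpa only [Formula.realize_inf, e₁, e₂] using hcon
    · intro h
      by_contra hcon
      refine hmin ⟨Fin m ⊕ γ, inferInstance, χ' ⊓ φ'.not, Sum.elim b c, hmem, ?_, ?_⟩
      · simpa only [Formula.realize_inf, Formula.realize_not, e₁, e₂] using ⟨hχ, hcon⟩
      · simp only [Formula.realize_inf, Formula.realize_not, e₁, e₂]
        exact fun h' => hn ⟨b, h, h'⟩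

theorem mk_sigma_formula_le :
    #(Σ m : ℕ, L.Formula (Unit ⊕ Fin m)) ≤ L.card + ℵ₀ := by
  have hle : ∀ m : ℕ, #(L.Formula (Unit ⊕ Fin m)) ≤ L.card + ℵ₀ := fun m => by
    have h1 : #(L.Formula (Unit ⊕ Fin m)) ≤ #(Σ n, L.BoundedFormula (Unit ⊕ Fin m) n) :=
      mk_le_of_injective (f := fun φ => ⟨0, φ⟩) (fun a b h => by simpa using h)
    refine h1.trans (BoundedFormula.card_le.trans ?_)
    refine max_le (self_le_add_left _ _) ?_
    rw [add_comm, lift_uzero]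
    gcongr
    exact (lift_lt_aleph0.2 (lt_aleph0_of_finite _)).le
  rw [mk_sigma]
  refine (Cardinal.sum_le_sum _ (fun _ => L.card + ℵ₀) hle).trans ?_
  rw [sum_const, mk_nat, lift_aleph0, lift_id']
  exact (mul_le_max_of_aleph0_le_left le_rfl).trans (max_le (self_le_add_left _ _) le_rfl)

theorem exists_definableTypeOver
    (h : ∀ (m : ℕ) (φ : L.Formula (Unit ⊕ Fin m)), ∃ n,
      ¬ Splits (fun (x : M) (y : Fin m → M) => φ.Realize (Sum.elim (fun _ => x) y)) n
        (fun _ => True)) (e : M) (X : Set M) :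
    ∃ B ⊆ X, Cardinal.lift.{max u v} #B ≤ Cardinal.lift.{w} (L.card + ℵ₀) ∧
      L.DefinableTypeOver e X B := by
  choose B hfin hBX D hD hD' using fun (m : ℕ) (φ : L.Formula (Unit ⊕ Fin m)) =>
    exists_finite_definable φ (h m φ) e X
  let F : (Σ m : ℕ, L.Formula (Unit ⊕ Fin m)) → Set M := fun p => B p.1 p.2
  refine ⟨⋃ p, F p, Set.iUnion_subset fun p => hBX _ _, ?_, fun m φ =>
    ⟨D m φ, (hD m φ).mono (Set.subset_iUnion F ⟨m, φ⟩), hD' m φ⟩⟩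
  refine (mk_iUnion_le_sum_mk_lift).trans ?_
  refine (Cardinal.sum_le_sum _ (fun _ => ℵ₀) fun p => (hfin _ _).countable.le_aleph0).trans ?_
  rw [sum_const, lift_aleph0]
  refine (mul_le_max_of_aleph0_le_right le_rfl).trans (max_le ?_ ?_)
  · exact lift_le.2 mk_sigma_formula_le
  · exact aleph0_le_lift.2 (self_le_add_left _ _)

end


/-! ### Stability excludes arbitrarily high trees -/

theorem Splits.exists_tree {α β : Type*} [Nonempty β] {R : α → β → Prop} {n : ℕ} :
    ∀ {P : α → Prop}, Splits R n P → ∃ t : List Bool → β, ∀ l : List Bool, l.length = n →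
      ∃ x, P x ∧ ∀ (l₁ : List Bool) (b : Bool) (l₂ : List Bool), l = l₁ ++ b :: l₂ →
        (R x (t l₁) ↔ b = true) := by
  induction n with
  | zero =>
    rintro P ⟨x, hx⟩
    refine ⟨fun _ => Classical.arbitrary β, fun l hl => ⟨x, hx, fun l₁ b l₂ h => ?_⟩⟩
    simp [List.length_eq_zero_iff.1 hl] at h
  | succ n ih =>
    rintro P ⟨y, h₁, h₀⟩
    obtain ⟨t₁, h₁⟩ := ih h₁
    obtain ⟨t₀, h₀⟩ := ih h₀
    refine ⟨fun l => match l with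
      | [] => y
      | true :: l => t₁ l
      | false :: l => t₀ l, fun l hl => ?_⟩
    match l with
    | true :: l =>
      obtain ⟨x, ⟨hP, hR⟩, hx⟩ := h₁ l (by simpa using hl)
      refine ⟨x, hP, fun l₁ b l₂ h => ?_⟩
      match l₁ with
      | [] => simp at h; simp [hR, ← h.1]
      | b' :: l₁ => simp at h; obtain ⟨rfl, h⟩ := h; exact hx l₁ b l₂ h
    | false :: l =>
      obtain ⟨x, ⟨hP, hR⟩, hx⟩ := h₀ l (by simpa using hl)
      refine ⟨x, hP, fun l₁ b l₂ h => ?_⟩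
      match l₁ with
      | [] => simp at h; simp [hR, ← h.1]
      | b' :: l₁ => simp at h; obtain ⟨rfl, h⟩ := h; exact hx l₁ b l₂ h

/-- Finite binary trees of all heights give, for every linear order `J` and every finite `S ⊆ J`,
a family of nodes such that all branches restricted to `S` are realized. -/
theorem exists_realize_branches {α β : Type*} [Nonempty β] {R : α → β → Prop}
    (h : ∀ n, Splits R n (fun _ => True)) {J : Type*} [LinearOrder J] (S : Finset J) :
    ∃ (d : (J → Bool) → α) (c : J → (J → Bool) → β),
      (∀ i η η', (∀ j < i, η j = η' j) → c i η = c i η') ∧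
      ∀ η, ∀ i ∈ S, (R (d η) (c i η) ↔ η i = true) := by
  obtain ⟨t, ht⟩ := (h S.card).exists_tree
  have ht' : ∀ η : J → Bool, _ := fun η => ht (S.sort.map η) (by simp)
  choose d hd hd' using ht'
  -- The node at `i` is named by the values of `η` on the part of `S` below `i`, a prefix of the
  -- word of the branch.
  refine ⟨d, fun i η => t ((S.filter (· < i)).sort.map η), fun i η η' h => ?_, fun η i hi => ?_⟩
  · refine congrArg t (List.map_congr_left fun j hj => h j ?_)
    rw [Finset.mem_sort, Finset.mem_filter] at hj
    exact hj.2
  · refine hd' η _ _ ((S.filter (i < ·)).sort.map η) ?_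
    have : S.sort = (S.filter (· < i)).sort ++ i :: (S.filter (i < ·)).sort := by
      refine List.Perm.eq_of_pairwise' (r := (· ≤ ·)) (Finset.pairwise_sort _ _) ?_ ?_
      · rw [List.pairwise_append, List.pairwise_cons]
        refine ⟨Finset.pairwise_sort _ _, ⟨fun j hj => ?_, Finset.pairwise_sort _ _⟩, fun j hj k hk => ?_⟩
        · simp at hj; exact hj.2.le
        · simp at hj hk
          rcases hk with rfl | hk
          · exact hj.2.le
          · exact (hj.2.trans hk.2).le
      · refine (List.perm_ext_iff_of_nodup (Finset.sort_nodup _ _) ?_).2 fun j => ?_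
        · rw [List.nodup_append, List.nodup_cons]
          refine ⟨Finset.sort_nodup _ _, ⟨by simp, Finset.sort_nodup _ _⟩, fun j hj k hk => ?_⟩
          simp at hj hk
          rcases hk with rfl | hk
          · exact hj.2.ne
          · exact (hj.2.trans hk.2).ne
        · simp
          rcases lt_trichotomy j i with h | rfl | h
          · simp [h, h.ne, h.le]
          · simp [hi]
          · simp [h, h.ne', h.le]
    rw [this]; simp

section

variable {L : Language.{u, v}} {M : Type w} [L.Structure M]

/-- Compactness with free variables, with control of the cardinality of the model. -/
theorem exists_model_realize [Infinite M] {T : L.Theory} [M ⊨ T] {P : Type w} (Γ : Set (L.Formula P))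
    (hΓ : ∀ Γ₀ : Finset (L.Formula P), ↑Γ₀ ⊆ Γ → ∃ v : P → M, ∀ ψ ∈ Γ₀, ψ.Realize v)
    (θ : Cardinal.{w}) (hθ : ℵ₀ ≤ θ) (hP : #P ≤ θ)
    (hL : Cardinal.lift.{w} L.card ≤ Cardinal.lift.{max u v} θ) :
    ∃ (N : Type w) (_ : L.Structure N) (_ : N ⊨ T) (v : P → N), #N = θ ∧
      ∀ ψ ∈ Γ, ψ.Realize v := by
  classical
  -- The complete theory of `M`, rather than `T`, forces models to be infinite, so that the
  -- cardinality can be adjusted.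
  let T' : L[[P]].Theory :=
    (L.lhomWithConstants P).onTheory (L.completeTheory M) ∪ Formula.equivSentence '' Γ
  have hT' : T'.IsSatisfiable := by
    rw [Theory.isSatisfiable_iff_isFinitelySatisfiable]
    intro T₀ hT₀
    let Γ₀ : Finset (L.Formula P) := (T₀.image Formula.equivSentence.symm).filter (· ∈ Γ)
    obtain ⟨v, hv⟩ := hΓ Γ₀ (by intro ψ hψ; simp [Γ₀] at hψ; exact hψ.2)
    let : (constantsOn P).Structure M := constantsOn.structure v
    have : M ⊨ (T₀ : L[[P]].Theory) := by
      rw [Theory.model_iff]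
      intro ψ hψ
      rcases hT₀ hψ with h | ⟨χ, hχ, rfl⟩
      · have : M ⊨ (L.lhomWithConstants P).onTheory (L.completeTheory M) :=
          (LHom.onTheory_model _ _).2 inferInstance
        exact this.realize_of_mem _ h
      · rw [Formula.realize_equivSentence]
        refine hv χ ?_
        simp only [Γ₀, Finset.mem_filter, Finset.mem_image]
        exact ⟨⟨_, hψ, by simp⟩, hχ⟩
    exact Theory.Model.isSatisfiable M
  obtain ⟨N₀⟩ := hT'
  have hN₀ : N₀ ⊨ (L.lhomWithConstants P).onTheory (L.completeTheory M) :=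
    N₀.is_model.mono Set.subset_union_left
  let : L.Structure N₀ := (L.lhomWithConstants P).reduct N₀
  have hN₀' : N₀ ⊨ L.completeTheory M := by
    rwa [← LHom.onTheory_model (L.lhomWithConstants P)]
  have hinf : Infinite N₀ := by
    rw [← model_infiniteTheory_iff L]
    exact hN₀'.mono (Theory.model_iff_subset_completeTheory.1
      ((model_infiniteTheory_iff L).2 inferInstance))
  obtain ⟨N, hN⟩ := Theory.exists_model_card_eq (T := T') ⟨N₀, hinf⟩ θ hθ (by
    rw [card_withConstants, lift_add, lift_lift, lift_lift]
    refine add_le_of_le (aleph0_le_lift.2 hθ) ?_ ?_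
    · simpa using lift_le.{w}.2 hL
    · simpa using lift_le.{max u v}.2 hP)
  have hN₁ : N ⊨ (L.lhomWithConstants P).onTheory (L.completeTheory M) :=
    N.is_model.mono Set.subset_union_left
  let : L.Structure N := (L.lhomWithConstants P).reduct N
  have hN₁' : N ⊨ L.completeTheory M := by
    rwa [← LHom.onTheory_model (L.lhomWithConstants P)]
  refine ⟨N, inferInstance, hN₁'.mono (Theory.model_iff_subset_completeTheory.1 inferInstance),
    fun p => (L.con p : N), hN, fun ψ hψ => ?_⟩
  rw [← Formula.realize_equivSentence]
  exact N.is_model.realize_of_mem _ (Or.inr ⟨ψ, hψ, rfl⟩)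

theorem typeOf_eq_iff [Nonempty M] (A : Set M) (x y : M) :
    (L[[A]].completeTheory M).typeOf (fun _ : Fin 1 => x) =
      (L[[A]].completeTheory M).typeOf (fun _ : Fin 1 => y) ↔
    ∀ D : Set (Fin 1 → M), A.Definable L D → ((fun _ => x) ∈ D ↔ (fun _ => y) ∈ D) := by
  rw [SetLike.ext_iff]
  simp only [Theory.CompleteType.mem_typeOf]
  constructor
  · rintro h D ⟨φ, rfl⟩
    simpa using h (Formula.equivSentence φ)
  · intro h φ
    exact h _ ⟨Formula.equivSentence.symm φ, rfl⟩

/-- For the least `μ` with `κ < 2 ^ μ`, a full tree of height `μ` has at most `κ` nodes but `2 ^ μ`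
branches, with distinct types over the nodes. -/
theorem Splits.exists_bound [Infinite M] {T : L.Theory} [M ⊨ T] {κ : Cardinal.{w}}
    (hκ : ℵ₀ ≤ κ) (hL : Cardinal.lift.{w} L.card ≤ Cardinal.lift.{max u v} κ)
    (hT : T.IsStableIn κ) {m : ℕ} (φ : L.Formula (Unit ⊕ Fin m)) :
    ∃ n, ¬ Splits (fun (x : M) (y : Fin m → M) => φ.Realize (Sum.elim (fun _ => x) y)) n
      (fun _ => True) := by
  classical
  by_contra! hsplit
  have hne : ∃ μ : Cardinal.{w}, κ < 2 ^ μ := ⟨κ, cantor κ⟩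
  obtain ⟨μ, hμ, hmin⟩ := WellFounded.has_min (wellFounded_lt (α := Cardinal.{w}))
    {μ | κ < 2 ^ μ} hne
  have hμκ : μ ≤ κ := not_lt.1 fun h => hmin κ (cantor κ) h
  let J : Type w := μ.ord.ToType
  let Node : Type w := Σ i : J, (Set.Iio i → Bool)
  have hNode : #Node ≤ κ := by
    rw [mk_sigma]
    refine (Cardinal.sum_le_sum _ (fun _ => κ) fun i => ?_).trans ?_
    · have : ¬ κ < 2 ^ #(Set.Iio i) := fun h => hmin _ h ((by simpa [J] using mk_Iio_lt i (by simp [J])))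
      simpa using this
    · rw [sum_const', mk_ord_toType]
      exact mul_le_of_le hκ hμκ le_rfl
  have hNodes : #(Node × Fin m) ≤ κ := by
    rw [mk_prod, lift_uzero]
    refine mul_le_of_le hκ hNode (le_trans ?_ hκ)
    exact (lift_lt_aleph0.2 (lt_aleph0_of_finite _)).le
  let P : Type w := (J → Bool) ⊕ (Node × Fin m)
  have hP : #P ≤ 2 ^ μ := by
    rw [mk_sum, lift_id, lift_id]
    refine add_le_of_le (hκ.trans hμ.le) ?_ (hNodes.trans hμ.le)
    simp [J]
  let node (i : J) (η : J → Bool) : Node := ⟨i, fun j => η j⟩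
  let χ (p : J × (J → Bool)) : L.Formula P :=
    φ.relabel (Sum.elim (fun _ => Sum.inl p.2) fun k => Sum.inr (node p.1 p.2, k))
  let ψ (p : J × (J → Bool)) : L.Formula P := if p.2 p.1 then χ p else (χ p).not
  have hχ : ∀ {N : Type w} [L.Structure N] (v : P → N) (i : J) (η : J → Bool),
      (χ (i, η)).Realize v ↔ φ.Realize (Sum.elim (fun _ => v (Sum.inl η))
        fun k => v (Sum.inr (node i η, k))) := fun v i η => by
    simp only [χ, Formula.realize_relabel]
    convert Iff.rfl using 2
    ext (k | k) <;> rfl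
  have hψ : ∀ {N : Type w} [L.Structure N] (v : P → N) (i : J) (η : J → Bool),
      (ψ (i, η)).Realize v ↔ ((χ (i, η)).Realize v ↔ η i = true) := fun v i η => by
    simp only [ψ]
    split_ifs with h <;> simp [h]
  obtain ⟨N, _, _, v, hN, hv⟩ := exists_model_realize (M := M) (T := T) (Set.range ψ) (by
    intro Γ₀ hΓ₀
    rw [← Set.image_univ, Finset.subset_set_image_iff] at hΓ₀
    obtain ⟨I, -, rfl⟩ := hΓ₀
    obtain ⟨d, c, hc, hd⟩ := exists_realize_branches hsplit (I.image Prod.fst)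
    refine ⟨Sum.elim d fun q => c q.1.1
      (fun j => if h : j < q.1.1 then q.1.2 ⟨j, h⟩ else false) q.2, fun χ' hχ' => ?_⟩
    obtain ⟨⟨i, η⟩, hp, rfl⟩ := Finset.mem_image.1 hχ'
    rw [hψ, hχ, ← hd η i (Finset.mem_image.2 ⟨_, hp, rfl⟩)]
    simp only [Sum.elim_inl, Sum.elim_inr, node]
    rw [hc i _ η fun j hj => by simp [hj] ]) (2 ^ μ) (hκ.trans hμ.le) hP
      (hL.trans (lift_le.2 hμ.le))
  have : Nonempty N := mk_ne_zero_iff.1 (by rw [hN]; exact (pos_of_gt hμ).ne')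
  -- Padding by `C` makes the parameter set have size exactly `κ`, as stability requires.
  obtain ⟨C, hC⟩ := le_mk_iff_exists_set.1 (hμ.le.trans hN.ge)
  let A : Set N := C ∪ Set.range fun q => v (Sum.inr q)
  have hA : #A = κ := by
    refine le_antisymm ((mk_union_le _ _).trans ?_) (hC.ge.trans (mk_le_mk_of_subset
      Set.subset_union_left))
    exact add_le_of_le hκ hC.le (mk_range_le.trans hNodes)
  have hinj : Function.Injective
      (fun η => (L[[A]].completeTheory N).typeOf (fun _ => v (Sum.inl η)) :
        (J → Bool) → L.OneTypes A) := by
    intro η η' h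
    by_contra hne
    -- At the first difference `i` both branches pass through the same node, whose instance of `φ`
    -- separates them.
    obtain ⟨i, hi, hlt⟩ := WellFounded.has_min (wellFounded_lt (α := J)) {i | η i ≠ η' i}
      (Function.ne_iff.1 hne)
    have hnode : node i η = node i η' := by
      simp only [node]
      congr 1
      ext ⟨j, hj⟩
      by_contra h
      exact hlt j (fun h' => h (by simp [h'])) hj
    have hdef := (typeOf_eq_iff A _ _).1 h _ (definable_setOf_realize
      (φ.relabel (Sum.elim (fun _ => Sum.inl (0 : Fin 1)) Sum.inr))
      (fun k => v (Sum.inr (node i η, k))) fun k => Or.inr ⟨_, rfl⟩)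
    have hre : ∀ η'' : J → Bool, (φ.relabel (Sum.elim (fun _ => Sum.inl (0 : Fin 1)) Sum.inr)).Realize
        (Sum.elim (fun _ => v (Sum.inl η'')) fun k => v (Sum.inr (node i η, k))) ↔
        φ.Realize (Sum.elim (fun _ => v (Sum.inl η'')) fun k => v (Sum.inr (node i η, k))) := by
      intro η''
      rw [Formula.realize_relabel]
      convert Iff.rfl using 2
      ext (k | k) <;> rfl
    simp only [Set.mem_ofPred_eq, hre] at hdef
    have h₁ := (hψ v i η).1 (hv _ ⟨_, rfl⟩)
    have h₂ := (hψ v i η').1 (hv _ ⟨_, rfl⟩)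
    rw [hχ] at h₁ h₂
    rw [← hnode] at h₂
    exact hi (Bool.eq_iff_iff.2 (h₁.symm.trans (hdef.trans h₂)))
  have hle := mk_le_of_injective (f := fun η : ULift.{max u v} (J → Bool) => _)
    (hinj.comp ULift.down_injective)
  rw [mk_uLift, hT N A hA, lift_le] at hle
  refine not_le_of_gt (show κ < 2 ^ μ from hμ) ?_
  simpa [J] using hle

end

end FirstOrder.Language

/-! ### Bounded sets and recursive choice -/

theorem Cardinal.exists_forall_lt_of_mk_le {c : Cardinal.{w}} (hc : ℵ₀ ≤ c)
    (S : Set (Order.succ c).ord.ToType) (hS : #S ≤ c) : ∃ x, ∀ y ∈ S, y < x := by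
  by_contra! h
  have := Order.cof_le (s := S) h
  rw [Ordinal.cof_toType, (isRegular_succ hc).cof_ord] at this
  exact (Order.succ_le_iff.1 (this.trans hS)).false

theorem exists_of_forall_exists_of_wellFoundedLT {ι β : Type*} [LinearOrder ι] [WellFoundedLT ι]
    {Q : ∀ i : ι, (Set.Iio i → β) → β → Prop} (h : ∀ i g, ∃ b, Q i g b) :
    ∃ f : ι → β, ∀ i, Q i (fun j => f j) (f i) := by
  choose F hF using h
  let f : ι → β := (wellFounded_lt (α := ι)).fix fun i g => F i fun j => g j j.2
  refine ⟨f, fun i => ?_⟩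
  have : f i = F i fun j => f j := WellFounded.fix_eq _ _ _
  rw [this]
  exact hF _ _

namespace FirstOrder.Language

/-! ### Definable types over a model and indiscernibility -/

section

variable {L : Language.{u, v}} {M : Type w} [L.Structure M]

theorem ElementarySubstructure.exists_mem_of_definable (N : L.ElementarySubstructure M) {m : ℕ}
    {D : Set (Fin m → M)} (hD : (N : Set M).Definable L D) (hne : D.Nonempty) :
    ∃ b ∈ D, ∀ k, b k ∈ N := by
  obtain ⟨φ, rfl⟩ := Set.definable_iff_exists_formula_sum.1 hD
  obtain ⟨b, hb⟩ := hne
  have h : (φ.iExs (Fin m)).Realize (N.subtype ∘ (id : N → N)) :=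
    Formula.realize_iExs.2 ⟨b, hb⟩
  rw [ElementaryEmbedding.map_formula, Formula.realize_iExs] at h
  obtain ⟨c, hc⟩ := h
  refine ⟨fun k => c k, ?_, fun k => (c k).2⟩
  rw [← ElementaryEmbedding.map_formula N.subtype] at hc
  rw [Set.mem_ofPred_eq]
  convert hc using 1
  ext (k | k) <;> rfl

/-- If the sets differed, their difference would be definable over `N` and so would contain a tuple
from `N`. -/
theorem ElementarySubstructure.definable_ext (N : L.ElementarySubstructure M) {m : ℕ}
    {D D' : Set (Fin m → M)} (hD : (N : Set M).Definable L D) (hD' : (N : Set M).Definable L D')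
    (h : ∀ b : Fin m → M, (∀ k, b k ∈ N) → (b ∈ D ↔ b ∈ D')) : D = D' := by
  have key : ∀ {D D' : Set (Fin m → M)}, (N : Set M).Definable L D → (N : Set M).Definable L D' →
      (∀ b : Fin m → M, (∀ k, b k ∈ N) → (b ∈ D ↔ b ∈ D')) → D ⊆ D' := by
    intro D D' hD hD' h b hb
    by_contra hb'
    obtain ⟨c, hc, hcN⟩ := N.exists_mem_of_definable (hD.sdiff hD') ⟨b, hb, hb'⟩
    exact hc.2 ((h c hcN).1 hc.1)
  exact (key hD hD' h).antisymm (key hD' hD fun b hb => (h b hb).symm)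

/-- A sequence whose terms have the same type over an elementary substructure `N`, and such that
the type of each term over `N` and the previous terms is definable over `N`, is indiscernible
over `N`. -/
theorem mem_iff_of_definableTypeOver {ι : Type*} [LinearOrder ι] (N : L.ElementarySubstructure M)
    (x : ι → M) (hdef : ∀ i, L.DefinableTypeOver (x i) (N ∪ x '' Set.Iio i) N)
    (htp : ∀ i j, ∀ D : Set (Fin 1 → M), (N : Set M).Definable L D →
      ((fun _ => x i) ∈ D ↔ (fun _ => x j) ∈ D)) (n : ℕ) :
    ∀ (s t : Fin n → ι), StrictMono s → StrictMono t → ∀ D : Set (Fin n → M),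
      (N : Set M).Definable L D → (x ∘ s ∈ D ↔ x ∘ t ∈ D) := by
  induction n with
  | zero => intro s t _ _ D _; rw [Subsingleton.elim s t]
  | succ n ih =>
    intro s t hs ht D hD
    -- The finitely many parameters become extra variables of `φ'`, whose distinguished variable is
    -- the last entry.
    obtain ⟨A₀, hA₀, hD⟩ := Set.definable_iff_finitely_definable.1 hD
    obtain ⟨φ, rfl⟩ := Set.definable_iff_exists_formula_sum.1 hD
    obtain ⟨r, ⟨e⟩⟩ := Finite.exists_equiv_fin (A₀ : Set M)
    let φ' : L.Formula (Unit ⊕ Fin (n + r)) := φ.relabel (Sum.elim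
      (fun a => Sum.inr (Fin.natAdd n (e a)))
      (Fin.lastCases (Sum.inl ()) fun k => Sum.inr (Fin.castAdd r k)))
    let c : Fin r → M := fun k => (e.symm k : M)
    have hc : ∀ k, c k ∈ N := fun k => hA₀ (e.symm k).2
    choose E hE hE' using fun i => hdef i _ φ'
    have hEE : ∀ i j, E i = E j := fun i j => by
      refine N.definable_ext (hE i) (hE j) fun b hb => ?_
      rw [← hE' i b fun k => Or.inl (hb k), ← hE' j b fun k => Or.inl (hb k)]
      have := htp i j _ (definable_setOf_realize
        (φ'.relabel (Sum.elim (fun _ => Sum.inl (0 : Fin 1)) Sum.inr)) b hb)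
      simp only [Set.mem_ofPred_eq, Formula.realize_relabel] at this
      convert this using 2 <;> ext (k | k) <;> rfl
    -- The common definition eliminates the last entry, leaving a condition over `N` on `n` entries.
    have hmem : ∀ s : Fin (n + 1) → ι, StrictMono s →
        (φ.Realize (Sum.elim (↑) (x ∘ s)) ↔
          x ∘ (s ∘ Fin.castSucc) ∈ {b : Fin n → M | Fin.append b c ∈ E (t (Fin.last n))}) := by
      intro s hs
      rw [Set.mem_ofPred_eq, hEE _ (s (Fin.last n)), ← hE']
      · simp only [φ', Formula.realize_relabel]
        convert Iff.rfl using 2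
        ext (a | k)
        · simp [c]
        · refine Fin.lastCases ?_ (fun k => ?_) k <;> simp
      · intro k
        refine Fin.addCases (fun k => ?_) (fun k => ?_) k
        · rw [Fin.append_left]
          exact Or.inr ⟨_, hs (Fin.castSucc_lt_last k), rfl⟩
        · rw [Fin.append_right]
          exact Or.inl (hc k)
    rw [Set.mem_ofPred_eq, Set.mem_ofPred_eq, hmem s hs, hmem t ht]
    refine ih _ _ (hs.comp Fin.strictMono_castSucc) (ht.comp Fin.strictMono_castSucc) _ ?_
    obtain ⟨ψ, hψ⟩ := Set.definable_iff_exists_formula_sum.1 (hE (t (Fin.last n)))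
    rw [Set.definable_iff_exists_formula_sum]
    refine ⟨ψ.relabel (Sum.elim Sum.inl (Fin.append Sum.inr fun k => Sum.inl ⟨c k, hc k⟩)), ?_⟩
    ext b
    rw [Set.mem_ofPred_eq, Set.mem_ofPred_eq, hψ, Set.mem_ofPred_eq, Formula.realize_relabel]
    convert Iff.rfl using 2
    ext (a | k)
    · rfl
    · refine Fin.addCases (fun k => ?_) (fun k => ?_) k <;> simp

/-! ### A model carrying cofinally many definable types -/

variable {κ : Cardinal.{w}} (a : (Order.succ κ).ord.ToType → M)

/-- At most `κ` types over `N` occur, so the failures at one representative of each combine into a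
single set and a single index bound. -/
theorem exists_definableTypeOver_step [Nonempty M] (hκ : ℵ₀ ≤ κ)
    (hstable : ∀ A : Set M, #A = κ → #(L.OneTypes A) = Cardinal.lift.{max u v} κ)
    (N : L.ElementarySubstructure M) (hN : #N = κ)
    (h : ∀ e : M, ∃ X : Set M, #X ≤ κ ∧ ∃ β, ∀ i, β < i →
      (∀ D : Set (Fin 1 → M), (N : Set M).Definable L D →
        ((fun _ => a i) ∈ D ↔ (fun _ => e) ∈ D)) → ¬ L.DefinableTypeOver (a i) X N) :
    ∃ X : Set M, (N : Set M) ⊆ X ∧ #X ≤ κ ∧ ∃ β, ∀ i, β < i →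
      ¬ L.DefinableTypeOver (a i) X N := by
  choose X hX β hβ using h
  let tp : M → L.OneTypes (N : Set M) := fun e =>
    (L[[(N : Set M)]].completeTheory M).typeOf fun _ : Fin 1 => e
  let rep : Set.range tp → M := fun q => q.2.choose
  have hrep : ∀ e, tp (rep ⟨tp e, e, rfl⟩) = tp e := fun e =>
    (⟨e, rfl⟩ : tp e ∈ Set.range tp).choose_spec
  have hE : #(Set.range rep) ≤ κ := by
    have h := mk_set_le (Set.range tp)
    rw [hstable _ hN, ← lift_le.{w}, lift_lift] at h
    rw [← lift_le.{max u v w}]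
    exact (mk_range_le_lift (f := rep)).trans h
  obtain ⟨γ, hγ⟩ := exists_forall_lt_of_mk_le hκ (β '' Set.range rep) (mk_image_le.trans hE)
  refine ⟨N ∪ ⋃ e : Set.range rep, X e, Set.subset_union_left, ?_, γ, fun i hi hdef => ?_⟩
  · refine (mk_union_le _ _).trans (add_le_of_le hκ hN.le ?_)
    exact ((mk_iUnion_le_sum_mk (f := fun e : Set.range rep => X e)).trans
      (sum_le_sum _ (fun _ => κ) fun e => hX e)).trans
      (by rw [sum_const']; exact mul_le_of_le hκ hE le_rfl)
  · let e := rep ⟨tp (a i), a i, rfl⟩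
    have he : e ∈ Set.range rep := ⟨_, rfl⟩
    refine hβ e i ((hγ _ ⟨e, he, rfl⟩).trans hi) ?_ (hdef.mono ?_ subset_rfl)
    · exact (typeOf_eq_iff _ _ _).1 (hrep (a i)).symm
    · exact Set.subset_union_of_subset_right (Set.subset_iUnion (fun e : Set.range rep => X e)
        ⟨e, he⟩) _

theorem exists_elementarySubstructure_definableTypeOver [Nonempty M] (hκ : ℵ₀ ≤ κ)
    (hκL : Cardinal.lift.{w} (L.card + ℵ₀) < Cardinal.lift.{max u v} κ) (hM : κ ≤ #M)
    (hstable : ∀ A : Set M, #A = κ → #(L.OneTypes A) = Cardinal.lift.{max u v} κ)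
    (hdef : ∀ (e : M) (X : Set M), ∃ B ⊆ X,
      Cardinal.lift.{max u v} #B ≤ Cardinal.lift.{w} (L.card + ℵ₀) ∧
      L.DefinableTypeOver e X B) :
    ∃ (N : L.ElementarySubstructure M) (e : M), #N = κ ∧ ∀ X : Set M, #X ≤ κ → ∀ β, ∃ i, β < i ∧
      (∀ D : Set (Fin 1 → M), (N : Set M).Definable L D →
        ((fun _ => a i) ∈ D ↔ (fun _ => e) ∈ D)) ∧ L.DefinableTypeOver (a i) X N := by
  by_contra! hno
  have hstep : ∀ N : L.ElementarySubstructure M, ∃ X : Set M, #X ≤ κ ∧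
      (#N = κ → (N : Set M) ⊆ X ∧ ∃ β, ∀ i, β < i → ¬ L.DefinableTypeOver (a i) X N) := by
    intro N
    by_cases hN : #N = κ
    · obtain ⟨X, h₁, h₂, h₃⟩ :=
        exists_definableTypeOver_step a hκ hstable N hN fun e => hno N e hN
      exact ⟨X, h₂, fun _ => ⟨h₁, h₃⟩⟩
    · exact ⟨∅, by simp, fun h => (hN h).elim⟩
  choose G hG hGN using hstep
  obtain ⟨ν, hν⟩ := mem_range_lift_of_le (hκL.le)
  have hν₀ : ℵ₀ ≤ ν := by
    rw [← aleph0_le_lift.{w, max u v}, hν, aleph0_le_lift]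
    exact self_le_add_left _ _
  -- This is where `|T| < κ` enters: a chain of length `ν⁺`, with `ν = |T|`, keeps its union of at
  -- most `κ` sets of size at most `κ` within `κ`.
  have hνκ : Order.succ ν ≤ κ := by
    rw [Order.succ_le_iff, ← lift_lt.{w, max u v}, hν]
    exact hκL
  obtain ⟨f, hf⟩ := exists_of_forall_exists_of_wellFoundedLT (ι := (Order.succ ν).ord.ToType)
    (β := L.ElementarySubstructure M) (Q := fun _ g N => #N = κ ∧ ∀ k, G (g k) ⊆ (N : Set M)) (fun j g => by
      obtain ⟨N, h₁, h₂⟩ := exists_elementarySubstructure_card_eq L (⋃ k, G (g k)) κ hκ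
        (lift_le.2 ((mk_iUnion_le_sum_mk.trans (sum_le_sum _ (fun _ => κ) fun k => hG _)).trans (by
          rw [sum_const']
          refine mul_le_of_le hκ ((mk_set_le _).trans ?_) le_rfl
          rwa [mk_ord_toType])))
        ((lift_le.2 (self_le_add_right _ _)).trans hκL.le) (lift_le.2 hM)
      exact ⟨N, lift_inj.1 h₂, fun k => (Set.subset_iUnion (fun k => G (g k)) k).trans h₁⟩)
  have hcard := fun j => (hf j).1
  have hsub : ∀ k j, k < j → G (f k) ⊆ f j := fun k j h => (hf j).2 ⟨k, h⟩
  choose hfG β hβ using fun j => hGN (f j) (hcard j)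
  -- This `i` lies beyond every failure bound of the chain, yet the base `B` of its type lies in one
  -- `f k`, by regularity of `ν⁺`.
  obtain ⟨i, hi⟩ := exists_forall_lt_of_mk_le hκ (Set.range β)
    (mk_range_le.trans (by rwa [mk_ord_toType]))
  obtain ⟨B, hB, hBcard, hBdef⟩ := hdef (a i) (⋃ j, f j)
  rw [← hν, lift_le] at hBcard
  choose j hj using fun b : B => Set.mem_iUnion.1 (hB b.2)
  obtain ⟨k, hk⟩ := exists_forall_lt_of_mk_le hν₀ (Set.range j) (mk_range_le.trans hBcard)
  -- A later stage `l` places `G (f k)` inside the union of the chain.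
  obtain ⟨l, hl⟩ := exists_forall_lt_of_mk_le hν₀ {k} (by simpa using one_le_aleph0.trans hν₀)
  refine hβ k i (hi _ ⟨k, rfl⟩) (hBdef.mono ?_ fun b hb => ?_)
  · exact (hsub k l (hl k rfl)).trans (Set.subset_iUnion (fun j => (f j : Set M)) l)
  · exact hsub _ _ (hk _ ⟨⟨b, hb⟩, rfl⟩) (hfG _ (hj ⟨b, hb⟩))

end

end FirstOrder.Language

/-! ### Extraction of the indiscernible subsequence -/

theorem mainTheorem7 {L : FirstOrder.Language.{u, v}} (T : L.Theory)
    (hT : T.IsComplete) (hinf : ∀ N : T.ModelType.{u, v, w}, Infinite N)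
    (κ : Cardinal.{w})
    (hκ : Cardinal.lift.{w} T.size < Cardinal.lift.{max u v} κ)
    (hstable : T.IsStableIn κ)
    (M : Type w) [L.Structure M] [M ⊨ T] [Nonempty M]
    (a : (Order.succ κ).ord.ToType → M) :
    ∃ I : Set (Order.succ κ).ord.ToType,
      #I = Order.succ κ ∧ L.IsIndiscernible (fun i : I => a i) := by
  have hκ₀ : ℵ₀ ≤ κ := by
    rw [← aleph0_le_lift.{w, max u v}]
    exact (aleph0_le_lift.2 (self_le_add_left _ _)).trans hκ.le
  have hL : Cardinal.lift.{w} L.card ≤ Cardinal.lift.{max u v} κ :=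
    (lift_le.2 (self_le_add_right _ _)).trans hκ.le
  rcases lt_or_ge κ #M with hM | hM
  · have : Infinite M := hinf (FirstOrder.Language.Theory.ModelType.of T M)
    obtain ⟨N, e, hN, h⟩ := FirstOrder.Language.exists_elementarySubstructure_definableTypeOver a
      hκ₀ hκ hM.le (hstable M) (FirstOrder.Language.exists_definableTypeOver fun m φ =>
        FirstOrder.Language.Splits.exists_bound hκ₀ hL hstable φ)
    obtain ⟨f, hf⟩ := exists_of_forall_exists_of_wellFoundedLT
      (ι := (Order.succ κ).ord.ToType) (Q := fun ξ (g : Set.Iio ξ → (Order.succ κ).ord.ToType) i => (∀ ζ, g ζ < i) ∧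
        (∀ D : Set (Fin 1 → M), (N : Set M).Definable L D →
          ((fun _ => a i) ∈ D ↔ (fun _ => e) ∈ D)) ∧
        L.DefinableTypeOver (a i) (N ∪ Set.range (a ∘ g)) N) (fun ξ g => by
      have hξ : #(Set.Iio ξ) ≤ κ := by
        rw [← Order.lt_succ_iff]
        simpa using mk_Iio_lt ξ (by simp)
      obtain ⟨β, hβ⟩ := exists_forall_lt_of_mk_le hκ₀ (Set.range g) (mk_range_le.trans hξ)
      obtain ⟨i, hi, h⟩ := h (N ∪ Set.range (a ∘ g)) ((mk_union_le _ _).trans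
        (add_le_of_le hκ₀ hN.le (mk_range_le.trans hξ))) β
      exact ⟨i, fun ζ => (hβ _ ⟨ζ, rfl⟩).trans hi, h⟩)
    have hmono : StrictMono f := fun ζ ξ h => (hf ξ).1 ⟨ζ, h⟩
    refine ⟨Set.range f, by rw [mk_range_eq f hmono.injective, mk_ord_toType],
      fun n s t hs ht φ => ?_⟩
    -- `g` inverts `f`, moving tuples from the range back to recursion indices.
    choose g hg using fun i : Set.range f => i.2
    have hgmono : StrictMono g := fun i j h => by
      rw [← hmono.lt_iff_lt, hg, hg]
      exact h
    have key := FirstOrder.Language.mem_iff_of_definableTypeOver N (a ∘ f) (fun i => by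
        rw [Set.image_eq_range]
        exact (hf i).2.2) (fun i j D hD => ((hf i).2.1 D hD).trans ((hf j).2.1 D hD).symm) n
      (g ∘ s) (g ∘ t) (hgmono.comp hs) (hgmono.comp ht) _
      ((Set.empty_definable_iff.2 ⟨φ, rfl⟩).mono (Set.empty_subset _))
    have hcomp : ∀ s : Fin n → Set.range f, (a ∘ f) ∘ (g ∘ s) = (fun i : Set.range f => a i) ∘ s :=
      fun s => by ext k; simp [hg]
    rwa [hcomp, hcomp] at key
  -- If `M` has at most `κ` elements, regularity of `κ⁺` gives a constant subsequence of full
  -- length.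
  · obtain ⟨e, he⟩ := infinite_pigeonhole a
      (by rw [mk_ord_toType]; exact hκ₀.trans (Order.le_succ κ))
      (by rw [mk_ord_toType, (isRegular_succ hκ₀).cof_ord]; exact Order.lt_succ_iff.2 hM)
    refine ⟨a ⁻¹' {e}, he.trans (mk_ord_toType _), fun n s t _ _ φ => ?_⟩
    have : ∀ s : Fin n → a ⁻¹' {e}, (fun i : a ⁻¹' {e} => a i) ∘ s = fun _ => e :=
      fun s => funext fun k => (s k).2
    rw [this, this]
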